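/- Let $G=(A,B,E)$ be a finite simple bipartite graph with nonempty color classes $A$ and $B$ and at least $4$ vertices. Here $N(X)$ is the set of vertices adjacent to some vertex of $X$; a stable set is a set of pairwise nonadjacent vertices; $\alpha(H)$ is the maximum size of a stable set of $H$; a graph $H$ is $\alpha^{+}$-stable if $\alpha(H+e)=\alpha(H)$ for every edge $e$ of the complement of $H$; and $G$ is balanced if $|A|=|B|$. The following assertions are equivalent: (i) $G$ is cover-irreducible, i.e. $G$ is balanced and its minimum vertex covers are exactly $A$ and $B$; (ii) $G$ is bistable, i.e. the maximum stable sets of $G$ are exactly $A$ and $B$; (iii) $|N(X)|>|X|$ for every nonempty proper subset $X$ of $A$ and for every nonempty proper subset $X$ of $B$; (iv) $G$ is balanced and $|N(X)|>|X|$ for every nonempty proper subset $X$ of $A$; (v) $G-a-b$ is $\alpha^{+}$-stable for all $a\in A$ and $b\in B$; (vi) $G-a-b$ has a perfect matching for all $a\in A$ and $b\in B$; (vii) $G$ is connected and every edge of $G$ lies in some perfect matching of $G$; (viii) $G$ is elementary, i.e. the union of all perfect matchings of $G$ is a (nonempty) connected subgraph of $G$; (ix) $G=G_0\cup H_1\cup\dots\cup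 H_k$ for some $k\ge 0$, where $G_0$ consists of two vertices and an edge joining them, and each $H_i$ is a path with an even number of vertices (possibly a single edge) that joins two vertices of $G_0\cup H_1\cup\dots\cup H_{i-1}$ in different color classes and has no other vertex in common with $G_0\cup H_1\cup\dots\cup H_{i-1}$. -/

import Mathlib

namespace BistableGraph

/-- `A`, `B` are the two color classes of the bipartite graph `G`: they are disjoint and nonempty,
they cover the vertex set, and every edge joins a vertex of `A` to a vertex of `B`. -/
structure IsBipartition {V : Type*} [Fintype V] [DecidableEq V]
    (G : SimpleGraph V) (A B : Finset V) : Prop where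
  isBipartiteWith : G.IsBipartiteWith (A : Set V) (B : Set V)
  union_eq : A ∪ B = Finset.univ
  left_nonempty : A.Nonempty
  right_nonempty : B.Nonempty

/-- A vertex cover of minimum cardinality. -/
structure IsMinVertexCover {V : Type*} (G : SimpleGraph V) (C : Finset V) : Prop where
  isVertexCover : G.IsVertexCover (C : Set V)
  minimum : ∀ D : Finset V, G.IsVertexCover (D : Set V) → C.card ≤ D.card

/-- Cover-irreducible: balanced, and the minimum vertex covers are exactly `A` and `B`. -/
def IsCoverIrreducible {V : Type*} (G : SimpleGraph V) (A B : Finset V) : Prop :=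
  A.card = B.card ∧ ∀ C : Finset V, IsMinVertexCover G C ↔ C = A ∨ C = B

/-- Bistable: the maximum stable sets are exactly `A` and `B`. -/
def IsBistable {V : Type*} [Finite V] (G : SimpleGraph V) (A B : Finset V) : Prop :=
  ∀ S : Finset V, G.IsMaximumIndepSet S ↔ S = A ∨ S = B

/-- The neighborhood `N(X)`, the union of the neighborhoods of the elements of `X`. -/
def nbhd {V : Type*} (G : SimpleGraph V) (X : Finset V) : Set V :=
  ⋃ x ∈ X, G.neighborSet x

/-- Every nonempty proper subset `X` of `A` satisfies `|N(X)| > |X|`. -/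
def HasSurplus {V : Type*} (G : SimpleGraph V) (A : Finset V) : Prop :=
  ∀ X : Finset V, X.Nonempty → X ⊂ A → X.card < (nbhd G X).ncard

/-- Adding any edge of the complement does not change the stability number. -/
def IsAlphaPlusStable {V : Type*} (G : SimpleGraph V) : Prop :=
  ∀ u v : V, Gᶜ.Adj u v → (G ⊔ SimpleGraph.edge u v).indepNum = G.indepNum

/-- The graph `G - a - b`. -/
def deletePair {V : Type*} (G : SimpleGraph V) (a b : V) :
    SimpleGraph ({a, b}ᶜ : Set V) :=
  G.induce ({a, b}ᶜ : Set V)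

/-- `G` has a perfect matching. -/
def HasPerfectMatching {V : Type*} (G : SimpleGraph V) : Prop :=
  ∃ M : G.Subgraph, M.IsPerfectMatching

/-- Every edge of `G` lies in some perfect matching of `G`. -/
def EveryEdgeMatched {V : Type*} (G : SimpleGraph V) : Prop :=
  ∀ u v : V, G.Adj u v → ∃ M : G.Subgraph, M.IsPerfectMatching ∧ M.Adj u v

/-- Elementary: the union of all perfect matchings is a connected subgraph
(connected subgraphs are nonempty, so a perfect matching has to exist). -/
def IsElementary {V : Type*} (G : SimpleGraph V) : Prop :=
  (sSup {M : G.Subgraph | M.IsPerfectMatching}).Connected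

/-- The walk `p` from `u` to `v` is an ear over the subgraph `H`: an even path, that is, a path on
an even number of vertices, whose ends `u` and `v` are vertices of `H` in different color classes
(it is read from its end in `A` to its end in `B`) and which has no other vertex in common
with `H`. A single edge is such a path, on two vertices. -/
structure IsEar {V : Type*} {G : SimpleGraph V} (A B : Finset V) (H : G.Subgraph)
    {u v : V} (p : G.Walk u v) : Prop where
  isPath : p.IsPath
  even : Even p.support.length
  start_mem_class : u ∈ A
  end_mem_class : v ∈ B
  start_mem : u ∈ H.verts
  end_mem : v ∈ H.verts
  inter : ∀ w ∈ p.support, w ∈ H.verts → w = u ∨ w = v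

/-- The subgraphs of `G` of the form `G₀ ∪ H₁ ∪ ⋯ ∪ Hₖ` (`k ≥ 0`), where `G₀` is an edge with its
two ends and each `Hᵢ` is an ear over `G₀ ∪ H₁ ∪ ⋯ ∪ Hᵢ₋₁`. -/
inductive EarBuilt {V : Type*} {G : SimpleGraph V} (A B : Finset V) : G.Subgraph → Prop
  | base {u v : V} (h : G.Adj u v) : EarBuilt A B (G.subgraphOfAdj h)
  | addEar {H : G.Subgraph} {u v : V} (p : G.Walk u v) (hH : EarBuilt A B H)
      (hp : IsEar A B H p) : EarBuilt A B (H ⊔ p.toSubgraph)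

/-- `G` itself is of the form `G₀ ∪ H₁ ∪ ⋯ ∪ Hₖ`. -/
def HasEarDecomposition {V : Type*} (G : SimpleGraph V) (A B : Finset V) : Prop :=
  EarBuilt A B (⊤ : G.Subgraph)

end BistableGraph

/-! The hub is (iv): balance together with surplus on `A`. For `X ⊆ A` the set `X ∪ (B \ N(X))` is
stable of size `|X| + |B| - |N(X)|`, so surplus says that a stable set meeting `A` in a nonempty
proper subset is never maximum. This gives (ii), (iii), (iv), and (i) by complementation. Surplus is
also Hall's condition with one vertex to spare, which is what deleting a pair `a`, `b` costs; hence
(vi), and then (vii), (viii). Back from (viii): a tight `X` is matched onto `N(X)` by every perfect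
matching, so no matching edge leaves `X ∪ N(X)`.

For (v), `α⁺`-stability means that at most one vertex lies in all maximum stable sets
(`isAlphaPlusStable_iff`). Maximum stable sets of a bipartite graph form a lattice, and its extreme
members meet `A`, respectively `B`, only in such common vertices; this yields Hall's condition when
the classes are balanced.

For (ix), an ear preserves bistability, because a maximum stable set must alternate along it
(`innerBound_of_isPath`). Conversely, with a perfect matching `m` fixed, surplus lets an
`m`-alternating path leave any `m`-closed proper subgraph meeting `A` and return to it, so a maximal
ear-built subgraph is all of `G` (`HasSurplus.hasEarDecomposition`). -/

namespace BistableGraph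

open SimpleGraph Finset

variable {V : Type*} {G : SimpleGraph V} {A B : Finset V}

/-! ### Color classes, and perfect matchings as partner functions -/

/-- `A` and `B` are complementary stable sets of `G`, possibly empty. -/
structure IsSplit (G : SimpleGraph V) (A B : Finset V) : Prop where
  notMem : ∀ v ∈ A, v ∉ B
  mem_or : ∀ v, v ∈ A ∨ v ∈ B
  left : ∀ u v, G.Adj u v → u ∈ A → v ∈ B
  right : ∀ u v, G.Adj u v → u ∈ B → v ∈ A

lemma IsSplit.symm (h : IsSplit G A B) : IsSplit G B A where
  notMem v hB hA := h.notMem v hA hB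
  mem_or v := (h.mem_or v).symm
  left := h.right
  right := h.left

lemma IsSplit.mem_right_iff (h : IsSplit G A B) {v : V} : v ∈ B ↔ v ∉ A :=
  ⟨fun hB hA => h.notMem v hA hB, fun hA => (h.mem_or v).resolve_left hA⟩

lemma IsBipartition.isSplit [Fintype V] [DecidableEq V] (h : IsBipartition G A B) :
    IsSplit G A B := by
  have hd : ∀ v ∈ A, v ∉ B := fun v hA hB =>
    Set.disjoint_left.1 h.isBipartiteWith.disjoint (mem_coe.2 hA) (mem_coe.2 hB)
  refine ⟨hd, fun v => ?_, fun u v huv hu => ?_, fun u v huv hu => ?_⟩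
  · have := mem_univ v
    rwa [← h.union_eq, mem_union] at this
  · rcases h.isBipartiteWith.mem_of_adj huv with h' | h'
    · exact h'.2
    · exact absurd h'.1 (hd u hu)
  · rcases h.isBipartiteWith.mem_of_adj huv with h' | h'
    · exact absurd hu (hd u h'.1)
    · exact h'.2

/-- `m` sends every vertex to its partner in a perfect matching. -/
structure IsMate (G : SimpleGraph V) (m : V → V) : Prop where
  adj : ∀ x, G.Adj x (m x)
  mate_mate : ∀ x, m (m x) = x

lemma IsMate.injective {m : V → V} (hm : IsMate G m) : Function.Injective m :=
  Function.LeftInverse.injective hm.mate_mate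

/-- The perfect matching described by a partner function. -/
def IsMate.subgraph {m : V → V} (hm : IsMate G m) : G.Subgraph where
  verts := Set.univ
  Adj x y := m x = y
  adj_sub := by
    rintro x _ rfl
    exact hm.adj x
  edge_vert _ := Set.mem_univ _
  symm := ⟨by
    rintro x _ rfl
    exact hm.mate_mate x⟩

lemma IsMate.isPerfectMatching {m : V → V} (hm : IsMate G m) :
    hm.subgraph.IsPerfectMatching := by
  rw [Subgraph.isPerfectMatching_iff]
  exact fun v => ⟨m v, rfl, fun y hy => Eq.symm hy⟩

lemma exists_isMate_of_isPerfectMatching {M : G.Subgraph} (hM : M.IsPerfectMatching) :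
    ∃ m, IsMate G m ∧ ∀ x y, M.Adj x y ↔ m x = y := by
  rw [Subgraph.isPerfectMatching_iff] at hM
  choose m hm hu using hM
  refine ⟨m, ⟨fun x => (hm x).adj_sub, fun x => (hu (m x) x (hm x).symm).symm⟩, fun x y => ?_⟩
  exact ⟨fun h => (hu x y h).symm, fun h => h ▸ hm x⟩

lemma hasPerfectMatching_iff : HasPerfectMatching G ↔ ∃ m, IsMate G m := by
  constructor
  · rintro ⟨M, hM⟩
    obtain ⟨m, hm, -⟩ := exists_isMate_of_isPerfectMatching hM
    exact ⟨m, hm⟩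
  · rintro ⟨m, hm⟩
    exact ⟨_, hm.isPerfectMatching⟩

lemma IsMate.mem_right {m : V → V} (hm : IsMate G m) (h : IsSplit G A B) {x : V} (hx : x ∈ A) :
    m x ∈ B := h.left _ _ (hm.adj x) hx

lemma IsMate.mem_left {m : V → V} (hm : IsMate G m) (h : IsSplit G A B) {x : V} (hx : x ∈ B) :
    m x ∈ A := h.right _ _ (hm.adj x) hx

lemma IsMate.card_eq {m : V → V} (hm : IsMate G m) (h : IsSplit G A B) : A.card = B.card :=
  card_nbij' m m (fun _ hx => hm.mem_right h hx) (fun _ hx => hm.mem_left h hx)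
    (fun x _ => hm.mate_mate x) (fun x _ => hm.mate_mate x)

/-- A stable set never contains both ends of a matching edge, so replacing its vertices in `B` by
their partners is injective. -/
lemma IsMate.card_le_of_isIndepSet {m : V → V} (hm : IsMate G m) (h : IsSplit G A B)
    {S : Finset V} (hS : G.IsIndepSet S) : S.card ≤ A.card := by
  classical
  refine card_le_card_of_injOn (fun x => if x ∈ A then x else m x) (fun x _ => ?_) ?_
  · simp only []
    split_ifs with hx
    · exact hx
    · exact hm.mem_left h (h.mem_right_iff.2 hx)
  · intro x hx y hy hxy
    have h1 : ∀ z, m z ∈ (S : Set V) → z ∈ (S : Set V) → False := fun z hz hz' =>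
      hS hz' hz (hm.adj z).ne (hm.adj z)
    simp only [] at hxy
    split_ifs at hxy with h2 h3 h3
    · exact hxy
    · exact (h1 y (hxy ▸ hx) hy).elim
    · exact (h1 x (hxy ▸ hy) hx).elim
    · exact hm.injective hxy

lemma isIndepSet_left (h : IsSplit G A B) : G.IsIndepSet (A : Set V) :=
  fun _ hu v hv _ huv => h.notMem v hv (h.left _ _ huv hu)

/-! ### Neighborhoods and Hall's theorem -/

section Fintype

variable [Fintype V]

open Classical in
/-- The neighborhood of a finite set as a finite set. -/
noncomputable def nbhdFinset (G : SimpleGraph V) (X : Finset V) : Finset V :=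
  univ.filter fun y => ∃ x ∈ X, G.Adj x y

lemma mem_nbhdFinset {X : Finset V} {y : V} : y ∈ nbhdFinset G X ↔ ∃ x ∈ X, G.Adj x y := by
  simp [nbhdFinset]

lemma ncard_nbhd (X : Finset V) : (nbhd G X).ncard = (nbhdFinset G X).card := by
  rw [← Set.ncard_coe_finset]
  congr 1
  ext y
  simp [nbhd, mem_nbhdFinset]

lemma hasSurplus_iff :
    HasSurplus G A ↔ ∀ X, X.Nonempty → X ⊂ A → X.card < (nbhdFinset G X).card := by
  simp [HasSurplus, ncard_nbhd]

lemma nbhdFinset_subset (h : IsSplit G A B) {X : Finset V} (hX : X ⊆ A) :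
    nbhdFinset G X ⊆ B := fun y hy => by
  obtain ⟨x, hx, hxy⟩ := mem_nbhdFinset.1 hy
  exact h.left _ _ hxy (hX hx)

lemma nbhdFinset_mono {X Y : Finset V} (hXY : X ⊆ Y) : nbhdFinset G X ⊆ nbhdFinset G Y :=
  fun y hy => by
  obtain ⟨x, hx, hxy⟩ := mem_nbhdFinset.1 hy
  exact mem_nbhdFinset.2 ⟨x, hXY hx, hxy⟩

/-- This exchange set turns bounds on stable sets into lower bounds on `|N(X)|`. -/
lemma isIndepSet_union_sdiff_nbhdFinset [DecidableEq V] (h : IsSplit G A B) {X : Finset V}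
    (hX : X ⊆ A) : G.IsIndepSet (X ∪ (B \ nbhdFinset G X) : Finset V) := by
  have h1 : ∀ u v, u ∈ X → v ∈ X ∪ (B \ nbhdFinset G X) → ¬ G.Adj u v := by
    intro u v hu hv huv
    rcases mem_union.1 hv with hv | hv
    · exact h.notMem v (hX hv) (h.left _ _ huv (hX hu))
    · exact (mem_sdiff.1 hv).2 (mem_nbhdFinset.2 ⟨u, hu, huv⟩)
  intro u hu v hv _ huv
  rw [mem_coe] at hu hv
  rcases mem_union.1 hu with hu' | hu'
  · exact h1 u v hu' hv huv
  · rcases mem_union.1 hv with hv' | hv'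
    · exact h1 v u hv' hu huv.symm
    · exact h.symm.notMem v (mem_sdiff.1 hv').1 (h.symm.left _ _ huv (mem_sdiff.1 hu').1)

lemma card_union_sdiff_nbhdFinset [DecidableEq V] (h : IsSplit G A B) {X : Finset V}
    (hX : X ⊆ A) :
    (X ∪ (B \ nbhdFinset G X)).card + (nbhdFinset G X).card = X.card + B.card := by
  rw [card_union_of_disjoint, add_assoc, card_sdiff_add_card_eq_card (nbhdFinset_subset h hX)]
  exact disjoint_left.2 fun x hx hx' => h.notMem x (hX hx) (mem_sdiff.1 hx').1

/-- Hall's marriage theorem for balanced bipartite graphs. -/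
lemma exists_isMate_of_hall (h : IsSplit G A B) (hc : A.card = B.card)
    (hall : ∀ X ⊆ A, X.card ≤ (nbhdFinset G X).card) : ∃ m, IsMate G m := by
  classical
  obtain ⟨f, hf, hfN⟩ := (Finset.all_card_le_biUnion_card_iff_exists_injective
    (fun a : A => nbhdFinset G {a.1})).1 (fun s => by
      have := hall (s.map (Function.Embedding.subtype _)) (fun x hx => by
        obtain ⟨y, -, rfl⟩ := mem_map.1 hx
        exact y.2)
      rw [card_map] at this
      refine this.trans (card_le_card fun y hy => ?_)
      obtain ⟨x, hx, hxy⟩ := mem_nbhdFinset.1 hy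
      obtain ⟨z, hz, rfl⟩ := mem_map.1 hx
      exact mem_biUnion.2 ⟨z, hz, mem_nbhdFinset.2 ⟨z, mem_singleton_self _, hxy⟩⟩)
  have hadj : ∀ a : A, G.Adj a (f a) := fun a => by
    obtain ⟨x, hx, hxy⟩ := mem_nbhdFinset.1 (hfN a)
    rwa [mem_singleton.1 hx] at hxy
  -- Balance makes Hall's injection onto `B`, so its inverse `g` supplies the partners of the
  -- vertices of `B`.
  have himg : univ.image f = B := by
    refine eq_of_subset_of_card_le (fun y hy => ?_) ?_
    · obtain ⟨a, -, rfl⟩ := mem_image.1 hy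
      exact h.left _ _ (hadj a) a.2
    · rw [card_image_of_injective _ hf, card_univ, Fintype.card_coe, hc]
  have hsurj : ∀ b, b ∉ A → ∃ a : A, f a = b := fun b hb => by
    have : b ∈ univ.image f := himg ▸ h.mem_right_iff.2 hb
    simpa using this
  choose g hg using hsurj
  have hfA : ∀ a : A, f a ∉ A := fun a => h.mem_right_iff.1 (h.left _ _ (hadj a) a.2)
  refine ⟨fun x => if hx : x ∈ A then f ⟨x, hx⟩ else g x hx, fun x => ?_, fun x => ?_⟩
  · by_cases hx : x ∈ A
    · simpa [hx] using hadj ⟨x, hx⟩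
    · have := hadj (g x hx)
      rw [hg] at this
      simpa [hx] using this.symm
  · by_cases hx : x ∈ A
    · have h1 : g (f ⟨x, hx⟩) (hfA _) = ⟨x, hx⟩ := hf (hg _ _)
      simp [hx, hfA, h1]
    · simp [hx, hg]

lemma IsMate.card_le_nbhdFinset {m : V → V} (hm : IsMate G m) (X : Finset V) :
    X.card ≤ (nbhdFinset G X).card :=
  card_le_card_of_injOn m (fun x hx => mem_nbhdFinset.2 ⟨x, hx, hm.adj x⟩) hm.injective.injOn

/-! ### `α⁺`-stability and the lattice of maximum stable sets -/

lemma isMaximumIndepSet_of_card_le {S T : Finset V} (hS : G.IsMaximumIndepSet S)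
    (hT : G.IsIndepSet (T : Set V)) (hc : S.card ≤ T.card) : G.IsMaximumIndepSet T :=
  ⟨hT, fun U hU => (hS.maximum U hU).trans hc⟩

/-- Adding `uv` lowers `α` exactly when every maximum stable set contains both ends. Adjacent pairs
satisfy the condition automatically, so it can range over all pairs. -/
lemma isAlphaPlusStable_iff : IsAlphaPlusStable G ↔
    ∀ u v, u ≠ v → ∃ S, G.IsMaximumIndepSet S ∧ ¬ (u ∈ S ∧ v ∈ S) := by
  constructor
  · intro h u v huv
    by_cases hadj : G.Adj u v
    · obtain ⟨S, hS⟩ := G.maximumIndepSet_exists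
      exact ⟨S, hS, fun ⟨h1, h2⟩ => hS.isIndepSet h1 h2 huv hadj⟩
    · obtain ⟨S, hS⟩ := (G ⊔ edge u v).exists_isNIndepSet_indepNum
      rw [h u v ⟨huv, hadj⟩] at hS
      refine ⟨S, ⟨fun x hx y hy hxy hxy' => hS.isIndepSet hx hy hxy (Or.inl hxy'), fun T hT => ?_⟩,
        fun ⟨h1, h2⟩ => hS.isIndepSet h1 h2 huv (Or.inr ?_)⟩
      · rw [hS.card_eq]
        exact hT.card_le_indepNum
      · simp [edge_adj, huv]
  · intro h u v huv
    obtain ⟨S, hS, hSuv⟩ := h u v huv.1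
    apply le_antisymm
    · obtain ⟨T, hT⟩ := (G ⊔ edge u v).exists_isNIndepSet_indepNum
      rw [← hT.card_eq]
      exact IsIndepSet.card_le_indepNum
        fun x hx y hy hxy hxy' => hT.isIndepSet hx hy hxy (Or.inl hxy')
    · rw [← G.maximumIndepSet_card_eq_indepNum S hS]
      refine IsIndepSet.card_le_indepNum fun x hx y hy hxy hxy' => ?_
      rcases hxy' with hxy' | hxy'
      · exact hS.isIndepSet hx hy hxy hxy'
      · rw [edge_adj] at hxy'
        rcases hxy'.1 with ⟨rfl, rfl⟩ | ⟨rfl, rfl⟩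
        · exact hSuv ⟨hx, hy⟩
        · exact hSuv ⟨hy, hx⟩

lemma IsMate.isAlphaPlusStable {m : V → V} (hm : IsMate G m) (h : IsSplit G A B) :
    IsAlphaPlusStable G := by
  rw [isAlphaPlusStable_iff]
  intro u v _
  have hA : G.IsMaximumIndepSet A :=
    ⟨isIndepSet_left h, fun T hT => hm.card_le_of_isIndepSet h hT⟩
  have hB : G.IsMaximumIndepSet B :=
    isMaximumIndepSet_of_card_le hA (isIndepSet_left h.symm) (hm.card_eq h).le
  by_cases hu : u ∈ A
  · exact ⟨B, hB, fun h' => h.notMem u hu h'.1⟩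
  · exact ⟨A, hA, fun h' => hu h'.1⟩

lemma card_inter_add_card_inter [DecidableEq V] (h : IsSplit G A B) (U : Finset V) :
    (U ∩ A).card + (U ∩ B).card = U.card := by
  have : B = univ \ A := by
    ext x
    simp [h.mem_right_iff]
  rw [this, ← inter_sdiff_assoc, inter_univ, add_comm, card_sdiff_add_card_inter]

/-- This set and its mirror image under swapping `A` and `B` are both stable, and their sizes add up
to `|S| + |T|`; as neither exceeds `α`, both attain it. -/
lemma IsMaximumIndepSet.inter_union [DecidableEq V] (h : IsSplit G A B) {S T : Finset V}
    (hS : G.IsMaximumIndepSet S) (hT : G.IsMaximumIndepSet T) :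
    G.IsMaximumIndepSet (S ∩ T ∩ A ∪ (S ∪ T) ∩ B) := by
  have key : ∀ {A B : Finset V}, IsSplit G A B →
      G.IsIndepSet (S ∩ T ∩ A ∪ (S ∪ T) ∩ B : Finset V) := by
    intro A B h
    have h1 : ∀ u v, u ∈ S ∩ T ∩ A → v ∈ (S ∪ T) ∩ B → ¬ G.Adj u v := by
      intro u v hu hv huv
      simp only [mem_inter, mem_union] at hu hv
      rcases hv.1 with hv' | hv'
      · exact hS.isIndepSet hu.1.1 hv' huv.ne huv
      · exact hT.isIndepSet hu.1.2 hv' huv.ne huv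
    intro u hu v hv _ huv
    rw [mem_coe] at hu hv
    rcases mem_union.1 hu with hu' | hu' <;> rcases mem_union.1 hv with hv' | hv'
    · exact h.notMem v (mem_inter.1 hv').2 (h.left _ _ huv (mem_inter.1 hu').2)
    · exact h1 _ _ hu' hv' huv
    · exact h1 _ _ hv' hu' huv.symm
    · exact h.symm.notMem v (mem_inter.1 hv').2 (h.symm.left _ _ huv (mem_inter.1 hu').2)
  refine isMaximumIndepSet_of_card_le hS (key h) ?_
  have h2 := hS.maximum _ (key h.symm)
  have hd : ∀ {A B : Finset V}, IsSplit G A B → (S ∩ T ∩ A ∪ (S ∪ T) ∩ B).card =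
      (S ∩ T ∩ A).card + ((S ∪ T) ∩ B).card := fun h => card_union_of_disjoint <|
    disjoint_left.2 fun x hx hx' => h.notMem x (mem_inter.1 hx).2 (mem_inter.1 hx').2
  rw [hd h.symm] at h2
  rw [hd h]
  have := card_union_add_card_inter S T
  have := card_inter_add_card_inter h (S ∩ T)
  have := card_inter_add_card_inter h (S ∪ T)
  have : S.card = T.card := le_antisymm (hT.maximum _ hS.isIndepSet) (hS.maximum _ hT.isIndepSet)
  omega

/-- Some maximum stable set meets `A` only in vertices common to all maximum stable sets. -/
lemma exists_isMaximumIndepSet_inter_subset [DecidableEq V] (h : IsSplit G A B) :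
    ∃ S, G.IsMaximumIndepSet S ∧ ∀ T, G.IsMaximumIndepSet T → S ∩ A ⊆ T := by
  classical
  obtain ⟨S₀, hS₀⟩ := G.maximumIndepSet_exists
  obtain ⟨S, hS, hmin⟩ := exists_min_image (univ.filter fun S => G.IsMaximumIndepSet S)
    (fun S => (S ∩ A).card) ⟨S₀, by simpa using hS₀⟩
  simp only [mem_filter, mem_univ, true_and] at hS hmin
  refine ⟨S, hS, fun T hT x hx => ?_⟩
  -- `S` has the smallest trace on `A`, so the lattice operation with `T` cannot shrink that trace.
  have h1 := hmin _ (IsMaximumIndepSet.inter_union h hS hT)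
  have h2 : (S ∩ T ∩ A ∪ (S ∪ T) ∩ B) ∩ A = S ∩ T ∩ A := by
    ext y
    have := h.notMem y
    simp only [mem_inter, mem_union]
    tauto
  rw [h2] at h1
  have h3 : S ∩ T ∩ A = S ∩ A :=
    eq_of_subset_of_card_le (fun y hy => by simp only [mem_inter] at hy ⊢; tauto) h1
  rw [← h3] at hx
  exact (mem_inter.1 (mem_inter.1 hx).1).2

/-- Take the two extreme members of the lattice: all vertices of `S ∩ A` and `T ∩ B` belong to every
maximum stable set, and `α⁺`-stability allows only one such vertex. -/
lemma IsAlphaPlusStable.exists_isMaximumIndepSet [DecidableEq V] (h : IsSplit G A B)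
    (hG : IsAlphaPlusStable G) : ∃ S T, G.IsMaximumIndepSet S ∧ G.IsMaximumIndepSet T ∧
      (S ∩ A).card + (T ∩ B).card ≤ 1 := by
  obtain ⟨S, hS, hSm⟩ := exists_isMaximumIndepSet_inter_subset h
  obtain ⟨T, hT, hTm⟩ := exists_isMaximumIndepSet_inter_subset h.symm
  refine ⟨S, T, hS, hT, ?_⟩
  rw [← card_union_of_disjoint
    (disjoint_left.2 fun x hx hx' => h.notMem x (mem_inter.1 hx).2 (mem_inter.1 hx').2)]
  rw [card_le_one]
  have hm : ∀ x ∈ S ∩ A ∪ T ∩ B, ∀ U, G.IsMaximumIndepSet U → x ∈ U := fun x hx U hU =>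
    (mem_union.1 hx).elim (fun h' => hSm U hU h') fun h' => hTm U hU h'
  intro x hx y hy
  by_contra hxy
  obtain ⟨U, hU, hxyU⟩ := isAlphaPlusStable_iff.1 hG x y hxy
  exact hxyU ⟨hm x hx U hU, hm y hy U hU⟩

/-- One of `S ∩ A`, `T ∩ B` is empty, so `α ≤ |A| = |B|`; applied to the exchange set, this is
Hall's condition. -/
lemma IsAlphaPlusStable.exists_isMate (h : IsSplit G A B) (hG : IsAlphaPlusStable G)
    (hc : A.card = B.card) : ∃ m, IsMate G m := by
  classical
  obtain ⟨S, T, hS, hT, hST⟩ := hG.exists_isMaximumIndepSet h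
  refine exists_isMate_of_hall h hc fun X hX => ?_
  have h1 := hS.maximum _ (isIndepSet_union_sdiff_nbhdFinset h hX)
  have h2 := hT.maximum _ (isIndepSet_union_sdiff_nbhdFinset h hX)
  have h3 := card_union_sdiff_nbhdFinset h hX
  have h4 := card_inter_add_card_inter h S
  have h5 := card_inter_add_card_inter h T
  have h6 := card_le_card (inter_subset_right : S ∩ B ⊆ B)
  have h7 := card_le_card (inter_subset_right : T ∩ A ⊆ A)
  omega

/-- Since `|S| ≥ |A| > |B|`, the trace `S ∩ A` is a single vertex, hence `S` contains all of `B` and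
that vertex has no neighbor. -/
lemma IsAlphaPlusStable.exists_isolated (h : IsSplit G A B) (hG : IsAlphaPlusStable G)
    (hc : B.card < A.card) : ∃ x ∈ A, ∀ y, ¬ G.Adj x y := by
  classical
  obtain ⟨S, T, hS, hT, hST⟩ := hG.exists_isMaximumIndepSet h
  have h1 := hS.maximum _ (isIndepSet_left h)
  have h4 := card_inter_add_card_inter h S
  have h6 := card_le_card (inter_subset_right : S ∩ B ⊆ B)
  have hpos : 0 < (S ∩ A).card := by omega
  obtain ⟨x, hx⟩ := card_pos.1 hpos
  have hB : S ∩ B = B := eq_of_subset_of_card_le inter_subset_right (by omega)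
  refine ⟨x, (mem_inter.1 hx).2, fun y hxy => ?_⟩
  have hy : y ∈ S ∩ B := by
    rw [hB]
    exact h.left _ _ hxy (mem_inter.1 hx).2
  exact hS.isIndepSet (mem_inter.1 hx).1 (mem_inter.1 hy).1 hxy.ne hxy

lemma IsMaximumIndepSet.mem_of_isolated {S : Finset V} (hS : G.IsMaximumIndepSet S) {x : V}
    (hx : ∀ y, ¬ G.Adj x y) : x ∈ S := by
  classical
  by_contra hxS
  have := hS.maximum (insert x S) (by
    intro u hu v hv huv hadj
    rw [mem_coe, mem_insert] at hu hv
    rcases hu with rfl | hu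
    · exact hx _ hadj
    · rcases hv with rfl | hv
      · exact hx _ hadj.symm
      · exact hS.isIndepSet hu hv huv hadj)
  rw [card_insert_of_notMem hxS] at this
  omega

end Fintype

/-! ### Deleting one vertex from each class -/

section DeletePair

lemma mem_compl_pair {a b x : V} : x ∈ ({a, b}ᶜ : Set V) ↔ x ≠ a ∧ x ≠ b := by
  simp

lemma deletePair_comm (a b : V) (P : ∀ {W : Type _}, SimpleGraph W → Prop)
    (h : P (deletePair G a b)) : P (deletePair G b a) := by
  unfold deletePair at *
  rwa [Set.pair_comm]

variable [DecidableEq V]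

/-- The part of a color class that survives in `G - a - b`. -/
noncomputable def restrictClass (A : Finset V) (a b : V) : Finset ({a, b}ᶜ : Set V) :=
  (A \ {a, b}).subtype _

lemma mem_restrictClass {a b : V} {x : ({a, b}ᶜ : Set V)} :
    x ∈ restrictClass A a b ↔ x.1 ∈ A := by
  have := mem_compl_pair.1 x.2
  simp [restrictClass, this]

lemma card_restrictClass (a b : V) : (restrictClass A a b).card = (A \ {a, b}).card := by
  classical
  rw [restrictClass, card_subtype, filter_true_of_mem]
  intro x hx
  simp only [mem_sdiff, mem_insert, mem_singleton] at hx
  exact mem_compl_pair.2 (by tauto)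

lemma IsSplit.restrict (h : IsSplit G A B) (a b : V) :
    IsSplit (deletePair G a b) (restrictClass A a b) (restrictClass B a b) where
  notMem v hA hB := h.notMem v.1 (mem_restrictClass.1 hA) (mem_restrictClass.1 hB)
  mem_or v := by simpa only [mem_restrictClass] using h.mem_or v.1
  left u v huv hu := by
    rw [mem_restrictClass] at *
    exact h.left _ _ huv hu
  right u v huv hu := by
    rw [mem_restrictClass] at *
    exact h.right _ _ huv hu

/-- A perfect matching of `G - a - b` extends by the edge `ab` to one of `G`. -/
lemma exists_isMate_of_deletePair {a b : V} (hab : G.Adj a b)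
    (hG : HasPerfectMatching (deletePair G a b)) : ∃ m, IsMate G m ∧ m a = b := by
  obtain ⟨m, hm⟩ := hasPerfectMatching_iff.1 hG
  have hba := hab.ne'
  let f : V → V := fun x => if hxa : x = a then b else if hxb : x = b then a else
    (m ⟨x, mem_compl_pair.2 ⟨hxa, hxb⟩⟩).1
  have hf : ∀ x : ({a, b}ᶜ : Set V), f x = m x := fun x => by
    have := mem_compl_pair.1 x.2
    simp [f, this]
  have hfa : f a = b := by simp [f]
  have hfb : f b = a := by simp [f, hba]
  refine ⟨f, ⟨fun x => ?_, fun x => ?_⟩, hfa⟩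
  · by_cases hxa : x = a
    · rwa [hxa, hfa]
    by_cases hxb : x = b
    · rw [hxb, hfb]
      exact hab.symm
    rw [hf ⟨x, mem_compl_pair.2 ⟨hxa, hxb⟩⟩]
    exact hm.adj ⟨x, _⟩
  · by_cases hxa : x = a
    · rw [hxa, hfa, hfb]
    by_cases hxb : x = b
    · rw [hxb, hfb, hfa]
    rw [hf ⟨x, mem_compl_pair.2 ⟨hxa, hxb⟩⟩, hf, hm.mate_mate]

lemma card_restrictClass_left (h : IsSplit G A B) {a b : V} (ha : a ∈ A) (hb : b ∈ B) :
    (restrictClass A a b).card + 1 = A.card := by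
  have h1 : A \ {a, b} = A.erase a := by
    ext x
    have := h.symm.notMem b hb
    simp only [mem_sdiff, mem_insert, mem_singleton, mem_erase]
    constructor
    · tauto
    · rintro ⟨h1, h2⟩
      refine ⟨h2, ?_⟩
      rintro (rfl | rfl) <;> tauto
  rw [card_restrictClass, h1, card_erase_add_one ha]

lemma card_restrictClass_right (h : IsSplit G A B) {a b : V} (ha : a ∈ A) (hb : b ∈ B) :
    (restrictClass B a b).card + 1 = B.card := by
  have := card_restrictClass_left h.symm hb ha
  rwa [card_restrictClass, Finset.pair_comm, ← card_restrictClass] at this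

lemma card_eq_of_hasPerfectMatching_deletePair (h : IsSplit G A B) {a b : V} (ha : a ∈ A)
    (hb : b ∈ B) (hG : HasPerfectMatching (deletePair G a b)) : A.card = B.card := by
  obtain ⟨m, hm⟩ := hasPerfectMatching_iff.1 hG
  have h1 := card_restrictClass_left h ha hb
  have h2 := card_restrictClass_right h ha hb
  have := hm.card_eq (h.restrict a b)
  omega

variable [Fintype V]

lemma exists_isolated_of_isAlphaPlusStable_deletePair (h : IsSplit G A B)
    (hG : ∀ a ∈ A, ∀ b ∈ B, IsAlphaPlusStable (deletePair G a b)) (hc : B.card < A.card)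
    {a b : V} (ha : a ∈ A) (hb : b ∈ B) :
    ∃ x ∈ A, x ≠ a ∧ ∀ y, y ≠ b → ¬ G.Adj x y := by
  have h1 := card_restrictClass_left h ha hb
  have h2 := card_restrictClass_right h ha hb
  obtain ⟨x, hx, hxy⟩ := (hG a ha b hb).exists_isolated (h.restrict a b) (by omega)
  rw [mem_restrictClass] at hx
  refine ⟨x, hx, (mem_compl_pair.1 x.2).1, fun y hy hadj => ?_⟩
  refine hxy ⟨y, mem_compl_pair.2 ⟨?_, hy⟩⟩ hadj
  rintro rfl
  exact h.notMem y ha (h.left _ _ hadj hx)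

/-- If `A` were larger, deleting pairs containing `b` would produce distinct `x`, `y` in `A` with no
neighbor but possibly `b`. Deleting `b` with a third vertex of `A` isolates both, so both lie in
every maximum stable set. -/
lemma card_le_of_isAlphaPlusStable_deletePair (h : IsSplit G A B) (hV : 4 ≤ A.card + B.card)
    (hB : B.Nonempty) (hG : ∀ a ∈ A, ∀ b ∈ B, IsAlphaPlusStable (deletePair G a b)) :
    A.card ≤ B.card := by
  by_contra! hc
  obtain ⟨b, hb⟩ := hB
  obtain ⟨a, ha⟩ := card_pos.1 (show 0 < A.card by omega)
  obtain ⟨x, hx, -, hxi⟩ := exists_isolated_of_isAlphaPlusStable_deletePair h hG hc ha hb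
  obtain ⟨y, hy, hyx, hyi⟩ := exists_isolated_of_isAlphaPlusStable_deletePair h hG hc hx hb
  -- Four vertices and `|A| > |B|` force `|A| ≥ 3`. The path on three vertices shows that fewer do
  -- not suffice.
  obtain ⟨z, hz, hzxy⟩ := exists_mem_notMem_of_card_lt_card
    (show ({x, y} : Finset V).card < A.card from card_le_two.trans_lt (by omega))
  simp only [mem_insert, mem_singleton, not_or] at hzxy
  have hne : ∀ u ∈ A, u ≠ b := fun u hu => by
    rintro rfl
    exact h.notMem u hu hb
  let x' : ({z, b}ᶜ : Set V) := ⟨x, mem_compl_pair.2 ⟨Ne.symm hzxy.1, hne x hx⟩⟩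
  let y' : ({z, b}ᶜ : Set V) := ⟨y, mem_compl_pair.2 ⟨Ne.symm hzxy.2, hne y hy⟩⟩
  obtain ⟨S, hS, hxyS⟩ := isAlphaPlusStable_iff.1 (hG z hz b hb) x' y'
    fun h' => hyx (congrArg Subtype.val h').symm
  exact hxyS ⟨IsMaximumIndepSet.mem_of_isolated hS fun w => hxi _ (mem_compl_pair.1 w.2).2,
    IsMaximumIndepSet.mem_of_isolated hS fun w => hyi _ (mem_compl_pair.1 w.2).2⟩

lemma card_eq_of_isAlphaPlusStable_deletePair (h : IsSplit G A B) (hV : 4 ≤ A.card + B.card)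
    (hA : A.Nonempty) (hB : B.Nonempty)
    (hG : ∀ a ∈ A, ∀ b ∈ B, IsAlphaPlusStable (deletePair G a b)) : A.card = B.card := by
  refine le_antisymm (card_le_of_isAlphaPlusStable_deletePair h hV hB hG)
    (card_le_of_isAlphaPlusStable_deletePair h.symm (by omega) hA fun b hb a ha => ?_)
  exact deletePair_comm a b IsAlphaPlusStable (hG a ha b hb)

lemma hasPerfectMatching_deletePair_iff_isAlphaPlusStable (h : IsSplit G A B)
    (hV : 4 ≤ A.card + B.card) (hA : A.Nonempty) (hB : B.Nonempty) :
    (∀ a ∈ A, ∀ b ∈ B, IsAlphaPlusStable (deletePair G a b)) ↔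
      ∀ a ∈ A, ∀ b ∈ B, HasPerfectMatching (deletePair G a b) := by
  constructor
  · intro hG a ha b hb
    rw [hasPerfectMatching_iff]
    refine (hG a ha b hb).exists_isMate (h.restrict a b) ?_
    have h1 := card_restrictClass_left h ha hb
    have h2 := card_restrictClass_right h ha hb
    have := card_eq_of_isAlphaPlusStable_deletePair h hV hA hB hG
    omega
  · intro hG a ha b hb
    obtain ⟨m, hm⟩ := hasPerfectMatching_iff.1 (hG a ha b hb)
    exact hm.isAlphaPlusStable (h.restrict a b)

/-- A set surviving in `A` misses `a`, hence is proper, and its surplus pays for the loss of `b`. -/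
lemma HasSurplus.hasPerfectMatching_deletePair (h : IsSplit G A B) (hc : A.card = B.card)
    (hG : HasSurplus G A) {a b : V} (ha : a ∈ A) (hb : b ∈ B) :
    HasPerfectMatching (deletePair G a b) := by
  rw [hasSurplus_iff] at hG
  rw [hasPerfectMatching_iff]
  have h1 := card_restrictClass_left h ha hb
  have h2 := card_restrictClass_right h ha hb
  refine exists_isMate_of_hall (h.restrict a b) (by omega) fun X hX => ?_
  rcases X.eq_empty_or_nonempty with rfl | hXn
  · simp
  let Y : Finset V := X.map (Function.Embedding.subtype _)
  have hY : ∀ x, x ∈ Y ↔ ∃ h, (⟨x, h⟩ : ({a, b}ᶜ : Set V)) ∈ X := fun x => by simp [Y]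
  have hYc : Y.card = X.card := card_map _
  have hYA : Y ⊂ A := by
    refine ⟨fun x hx => ?_, fun h' => ?_⟩
    · obtain ⟨_, hx'⟩ := (hY x).1 hx
      exact mem_restrictClass.1 (hX hx')
    · obtain ⟨h'', -⟩ := (hY a).1 (h' ha)
      exact (mem_compl_pair.1 h'').1 rfl
  have hlt := hG Y (hXn.map) hYA
  have hsub : (nbhdFinset G Y).erase b ⊆
      (nbhdFinset (deletePair G a b) X).map (Function.Embedding.subtype _) := fun y hy => by
    rw [mem_erase] at hy
    obtain ⟨x, hx, hxy⟩ := mem_nbhdFinset.1 hy.2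
    obtain ⟨hx', hxX⟩ := (hY x).1 hx
    have hya : y ≠ a := by
      rintro rfl
      exact h.notMem y ha (h.left _ _ hxy (hYA.1 hx))
    exact mem_map.2 ⟨⟨y, mem_compl_pair.2 ⟨hya, hy.1⟩⟩, mem_nbhdFinset.2 ⟨_, hxX, hxy⟩, rfl⟩
  have := card_le_card hsub
  rw [card_map] at this
  have := (nbhdFinset G Y).pred_card_le_card_erase (a := b)
  omega

/-- With `a ∈ A \ X`, a perfect matching of `G - a - b` embeds `X` in `N(X) \ {b}`. Any `b` shows
that `N(X)` is nonempty; then `b ∈ N(X)` makes the inequality strict. -/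
lemma hasSurplus_of_hasPerfectMatching_deletePair (h : IsSplit G A B) (hB : B.Nonempty)
    (hG : ∀ a ∈ A, ∀ b ∈ B, HasPerfectMatching (deletePair G a b)) : HasSurplus G A := by
  rw [hasSurplus_iff]
  intro X hX hXA
  obtain ⟨a, ha, haX⟩ := exists_of_ssubset hXA
  have key : ∀ b ∈ B, X.card ≤ ((nbhdFinset G X).erase b).card := by
    intro b hb
    obtain ⟨m, hm⟩ := hasPerfectMatching_iff.1 (hG a ha b hb)
    have hXc : ∀ x ∈ X, x ∈ ({a, b}ᶜ : Set V) := fun x hx => mem_compl_pair.2 ⟨by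
      rintro rfl
      exact haX hx, by
      rintro rfl
      exact h.notMem x (hXA.1 hx) hb⟩
    have h1 := hm.card_le_nbhdFinset (X.subtype _)
    rw [card_subtype, filter_true_of_mem hXc] at h1
    refine h1.trans ?_
    rw [← card_map (Function.Embedding.subtype _)]
    refine card_le_card fun y hy => ?_
    obtain ⟨z, hz, rfl⟩ := mem_map.1 hy
    obtain ⟨x, hx, hxz⟩ := mem_nbhdFinset.1 hz
    exact mem_erase.2 ⟨(mem_compl_pair.1 z.2).2, mem_nbhdFinset.2 ⟨x, mem_subtype.1 hx, hxz⟩⟩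
  obtain ⟨b, hb⟩ := hB
  have h1 : 0 < (nbhdFinset G X).card :=
    (card_pos.2 hX).trans_le ((key b hb).trans (card_le_card (erase_subset _ _)))
  obtain ⟨b', hb'⟩ := card_pos.1 h1
  exact (key b' (nbhdFinset_subset h hXA.1 hb')).trans_lt (card_erase_lt_of_mem hb')

end DeletePair

/-! ### Surplus, bistability and elementary graphs -/

section Surplus

lemma everyEdgeMatched_of_hasPerfectMatching_deletePair [DecidableEq V] (h : IsSplit G A B)
    (hG : ∀ a ∈ A, ∀ b ∈ B, HasPerfectMatching (deletePair G a b)) : EveryEdgeMatched G := by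
  have key : ∀ a ∈ A, ∀ b, G.Adj a b → ∃ M : G.Subgraph, M.IsPerfectMatching ∧ M.Adj a b := by
    intro a ha b hab
    obtain ⟨m, hm, hmab⟩ := exists_isMate_of_deletePair hab (hG a ha b (h.left _ _ hab ha))
    exact ⟨hm.subgraph, hm.isPerfectMatching, hmab⟩
  intro u v huv
  rcases h.mem_or u with hu | hu
  · exact key u hu v huv
  · obtain ⟨M, hM, hMuv⟩ := key v (h.right _ _ huv hu) u huv.symm
    exact ⟨M, hM, hMuv.symm⟩

lemma isElementary_of_everyEdgeMatched [Nontrivial V] (hc : G.Connected)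
    (hG : EveryEdgeMatched G) : IsElementary G := by
  have htop : sSup {M : G.Subgraph | M.IsPerfectMatching} = ⊤ := by
    have hadj : ∀ u v, G.Adj u v → (sSup {M : G.Subgraph | M.IsPerfectMatching}).Adj u v := by
      intro u v huv
      obtain ⟨M, hM, hMuv⟩ := hG u v huv
      exact Subgraph.sSup_adj.2 ⟨M, hM, hMuv⟩
    refine top_unique ⟨fun v _ => ?_, fun u v huv => hadj u v huv⟩
    obtain ⟨w, hw⟩ := hc.preconnected.exists_adj_of_nontrivial v
    exact (hadj v w hw).fst_mem
  rw [IsElementary, htop, Subgraph.connected_iff']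
  exact Subgraph.topIso.connected_iff.2 hc

lemma IsElementary.exists_isPerfectMatching (hG : IsElementary G) :
    ∃ M : G.Subgraph, M.IsPerfectMatching := by
  obtain ⟨v, hv⟩ := hG.nonempty
  rw [Subgraph.verts_sSup, Set.mem_iUnion₂] at hv
  obtain ⟨M, hM, -⟩ := hv
  exact ⟨M, hM⟩

/-- The form in which connectedness is used: every cut is crossed by an edge of some perfect
matching. -/
lemma IsElementary.exists_adj_of_notMem (hG : IsElementary G) {S : Set V} {x y : V}
    (hx : x ∈ S) (hy : y ∉ S) :
    ∃ M : G.Subgraph, M.IsPerfectMatching ∧ ∃ u ∈ S, ∃ v ∉ S, M.Adj u v := by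
  have hspan : ∀ z, z ∈ (sSup {M : G.Subgraph | M.IsPerfectMatching}).verts := fun z => by
    obtain ⟨M, hM⟩ := hG.exists_isPerfectMatching
    rw [Subgraph.verts_sSup]
    exact Set.mem_iUnion₂.2 ⟨M, hM, hM.2 z⟩
  obtain ⟨p⟩ := hG.coe.preconnected ⟨x, hspan x⟩ ⟨y, hspan y⟩
  obtain ⟨d, -, hd1, hd2⟩ := p.exists_boundary_dart (Subtype.val ⁻¹' S) hx hy
  obtain ⟨M, hM, hMd⟩ := Subgraph.sSup_adj.1 d.adj
  exact ⟨M, hM, _, hd1, _, hd2, hMd⟩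

variable [Fintype V]

lemma isMinVertexCover_iff [DecidableEq V] {C : Finset V} :
    IsMinVertexCover G C ↔ G.IsMaximumIndepSet Cᶜ := by
  have h1 : ∀ D : Finset V, G.IsVertexCover (D : Set V) ↔ G.IsIndepSet (Dᶜ : Finset V) :=
    fun D => by rw [coe_compl, isIndepSet_compl_iff_isVertexCover]
  have h2 : ∀ D : Finset V, D.card + Dᶜ.card = Fintype.card V := fun D => by
    rw [card_add_card_compl]
  constructor
  · rintro ⟨hC, hmin⟩
    refine ⟨(h1 C).1 hC, fun T hT => ?_⟩
    have := hmin Tᶜ ((h1 _).2 (by rwa [compl_compl]))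
    have := h2 C
    have := h2 T
    omega
  · rintro ⟨hC, hmax⟩
    refine ⟨(h1 C).2 hC, fun D hD => ?_⟩
    have := hmax Dᶜ ((h1 D).1 hD)
    have := h2 C
    have := h2 D
    omega

lemma IsSplit.compl_eq [DecidableEq V] (h : IsSplit G A B) : Aᶜ = B := by
  ext x
  rw [mem_compl, h.mem_right_iff]

lemma IsBistable.card_eq (hG : IsBistable G A B) : A.card = B.card :=
  le_antisymm (((hG B).2 (Or.inr rfl)).maximum _ ((hG A).2 (Or.inl rfl)).isIndepSet)
    (((hG A).2 (Or.inl rfl)).maximum _ ((hG B).2 (Or.inr rfl)).isIndepSet)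

lemma IsBistable.symm (hG : IsBistable G A B) : IsBistable G B A := fun S => by
  rw [hG S, or_comm]

lemma isCoverIrreducible_iff_isBistable (h : IsSplit G A B) :
    IsCoverIrreducible G A B ↔ IsBistable G A B := by
  classical
  have hc : ∀ C : Finset V, (Cᶜ = A ∨ Cᶜ = B) ↔ (C = A ∨ C = B) := fun C => by
    rw [compl_eq_comm, compl_eq_comm (x := C) (y := B), h.compl_eq, h.symm.compl_eq, or_comm,
      eq_comm, @eq_comm _ B C]
  constructor
  · rintro ⟨-, hG⟩ S
    rw [← hc, ← hG, isMinVertexCover_iff, compl_compl]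
  · intro hG
    refine ⟨hG.card_eq, fun C => ?_⟩
    rw [isMinVertexCover_iff, hG, hc]

/-- Without surplus the exchange set is a maximum stable set; it meets `X`, so it is not `B`, and it
misses a vertex of `A \ X`, so it is not `A`. -/
lemma IsBistable.hasSurplus (h : IsSplit G A B) (hG : IsBistable G A B) : HasSurplus G A := by
  classical
  rw [hasSurplus_iff]
  intro X hX hXA
  by_contra! hlt
  have h1 := card_union_sdiff_nbhdFinset h hXA.1
  have h2 := isMaximumIndepSet_of_card_le ((hG B).2 (Or.inr rfl))
    (isIndepSet_union_sdiff_nbhdFinset h hXA.1) (by omega)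
  obtain ⟨x, hx⟩ := hX
  obtain ⟨a, ha, haX⟩ := exists_of_ssubset hXA
  have hx' : x ∈ X ∪ (B \ nbhdFinset G X) := mem_union_left _ hx
  rcases (hG _).1 h2 with h3 | h3
  · rw [← h3] at ha
    rcases mem_union.1 ha with ha' | ha'
    · exact haX ha'
    · have : a ∈ A := h3 ▸ ha
      exact h.notMem a this (mem_sdiff.1 ha').1
  · rw [h3] at hx'
    exact h.notMem x (hXA.1 hx) hx'

/-- Surplus concerns proper subsets only, so it is applied to `A` minus one vertex, which is
nonempty as `|A| ≥ 2`. -/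
lemma HasSurplus.card_le (hA : 2 ≤ A.card) (hG : HasSurplus G A) :
    A.card ≤ (nbhdFinset G A).card := by
  classical
  rw [hasSurplus_iff] at hG
  obtain ⟨a, ha⟩ := card_pos.1 (show 0 < A.card by omega)
  have h1 := card_erase_add_one ha
  have h2 := hG (A.erase a) (card_pos.1 (by omega)) (erase_ssubset ha)
  have h3 := card_le_card (nbhdFinset_mono (G := G) (erase_subset a A))
  omega

lemma card_eq_of_hasSurplus (h : IsSplit G A B) (hV : 4 ≤ A.card + B.card)
    (hA : HasSurplus G A) (hB : HasSurplus G B) : A.card = B.card := by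
  have h1 := fun hA' => (hA.card_le hA').trans (card_le_card (nbhdFinset_subset h subset_rfl))
  have h2 := fun hB' =>
    (hB.card_le hB').trans (card_le_card (nbhdFinset_subset h.symm subset_rfl))
  omega

/-- For stable `S` with nonempty proper trace `X` on `A`, the rest of `S` avoids `N(X)`, so `|S| ≤
|X| + |B| - |N(X)| < |B|`. The two extreme traces lead to `S ⊆ B` and, as `N(A) = B`, to `S = A`. -/
lemma HasSurplus.isBistable (h : IsSplit G A B) (hA : 2 ≤ A.card) (hc : A.card = B.card)
    (hG : HasSurplus G A) : IsBistable G A B := by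
  classical
  have hN : nbhdFinset G A = B :=
    eq_of_subset_of_card_le (nbhdFinset_subset h subset_rfl) (hc ▸ hG.card_le hA)
  rw [hasSurplus_iff] at hG
  have key : ∀ S : Finset V, G.IsIndepSet S → S = A ∨ S = B ∨ S.card < B.card := by
    intro S hS
    have h1 := card_inter_add_card_inter h S
    have hsub : S ∩ B ⊆ B \ nbhdFinset G (S ∩ A) := fun y hy => by
      refine mem_sdiff.2 ⟨(mem_inter.1 hy).2, fun hy' => ?_⟩
      obtain ⟨x, hx, hxy⟩ := mem_nbhdFinset.1 hy'
      exact hS (mem_inter.1 hx).1 (mem_inter.1 hy).1 hxy.ne hxy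
    have hNB := card_sdiff_add_card_eq_card
      (nbhdFinset_subset (X := S ∩ A) h inter_subset_right)
    have h2 := card_le_card hsub
    rcases (S ∩ A).eq_empty_or_nonempty with he | hne
    · have hSB : S ⊆ B := fun x hx => by
        refine h.mem_right_iff.2 fun hxA => ?_
        have : x ∈ S ∩ A := mem_inter.2 ⟨hx, hxA⟩
        rw [he] at this
        exact notMem_empty x this
      rcases eq_or_ssubset_of_subset hSB with h3 | h3
      · exact Or.inr (Or.inl h3)
      · exact Or.inr (Or.inr (card_lt_card h3))
    · rcases eq_or_ssubset_of_subset (inter_subset_right : S ∩ A ⊆ A) with h3 | h3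
      · rw [h3, hN, sdiff_self] at hsub
        refine Or.inl (Finset.Subset.antisymm (fun x hx => ?_) (inter_eq_right.1 h3))
        by_contra hxA
        exact notMem_empty x (hsub (mem_inter.2 ⟨hx, h.mem_right_iff.2 hxA⟩))
      · have := hG _ hne h3
        exact Or.inr (Or.inr (by omega))
  intro S
  constructor
  · intro hS
    rcases key S hS.isIndepSet with h1 | h1 | h1
    · exact Or.inl h1
    · exact Or.inr h1
    · have := hS.maximum B (isIndepSet_left h.symm)
      omega
  · have hmax : ∀ T : Finset V, G.IsIndepSet T → T.card ≤ B.card := fun T hT => by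
      rcases key T hT with h1 | h1 | h1
      · rw [h1, hc]
      · rw [h1]
      · exact h1.le
    rintro (rfl | rfl)
    · exact ⟨isIndepSet_left h, fun T hT => hc ▸ hmax T hT⟩
    · exact ⟨isIndepSet_left h.symm, hmax⟩

/-- If `A` split into reachable and unreachable parts, their neighborhoods would be disjoint subsets
of `B` with at least `|A| + 2` vertices in total. -/
lemma HasSurplus.connected (h : IsSplit G A B) (hA : 2 ≤ A.card) (hc : A.card = B.card)
    (hG : HasSurplus G A) : G.Connected := by
  classical
  have hN : nbhdFinset G A = B :=
    eq_of_subset_of_card_le (nbhdFinset_subset h subset_rfl) (hc ▸ hG.card_le hA)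
  rw [hasSurplus_iff] at hG
  obtain ⟨a, ha⟩ := card_pos.1 (show 0 < A.card by omega)
  have hAr : ∀ x ∈ A, G.Reachable a x := by
    by_contra! hex
    obtain ⟨z, hz, hza⟩ := hex
    have h1 := hG (A.filter (G.Reachable a)) ⟨a, by simp [ha]⟩
      ⟨filter_subset _ _, fun h' => hza (mem_filter.1 (h' hz)).2⟩
    have h2 := hG (A.filter fun x => ¬ G.Reachable a x) ⟨z, by simp [hz, hza]⟩
      ⟨filter_subset _ _, fun h' => (mem_filter.1 (h' ha)).2 (Reachable.refl _)⟩
    have h3 := card_filter_add_card_filter_not (s := A) (G.Reachable a)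
    have h4 : Disjoint (nbhdFinset G (A.filter (G.Reachable a)))
        (nbhdFinset G (A.filter fun x => ¬ G.Reachable a x)) := disjoint_left.2 fun y hy hy' => by
      obtain ⟨x, hx, hxy⟩ := mem_nbhdFinset.1 hy
      obtain ⟨x', hx', hxy'⟩ := mem_nbhdFinset.1 hy'
      exact (mem_filter.1 hx').2 (((mem_filter.1 hx).2.trans hxy.reachable).trans
        hxy'.symm.reachable)
    have h5 := card_le_card (union_subset
      (nbhdFinset_subset (X := A.filter (G.Reachable a)) h (filter_subset _ _))
      (nbhdFinset_subset (X := A.filter fun x => ¬ G.Reachable a x) h (filter_subset _ _)))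
    rw [card_union_of_disjoint h4] at h5
    omega
  have hr : ∀ x, G.Reachable a x := fun x => by
    rcases h.mem_or x with hx | hx
    · exact hAr x hx
    · rw [← hN] at hx
      obtain ⟨y, hy, hyx⟩ := mem_nbhdFinset.1 hx
      exact (hAr y hy).trans hyx.reachable
  have : Nonempty V := ⟨a⟩
  exact ⟨fun x y => (hr x).symm.trans (hr y)⟩

/-- If `|N(X)| ≤ |X|`, every perfect matching maps `X` onto `N(X)`, so none crosses the boundary of
`X ∪ N(X)`. -/
lemma IsElementary.hasSurplus (h : IsSplit G A B) (hG : IsElementary G) :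
    A.card = B.card ∧ HasSurplus G A := by
  classical
  obtain ⟨M₀, hM₀⟩ := hG.exists_isPerfectMatching
  obtain ⟨m₀, hm₀, -⟩ := exists_isMate_of_isPerfectMatching hM₀
  refine ⟨hm₀.card_eq h, hasSurplus_iff.2 fun X hX hXA => ?_⟩
  by_contra! hle
  obtain ⟨x, hx⟩ := hX
  obtain ⟨a, ha, haX⟩ := exists_of_ssubset hXA
  have haN : a ∉ nbhdFinset G X := fun h' => h.notMem a ha (nbhdFinset_subset h hXA.1 h')
  obtain ⟨M, hM, u, hu, v, hv, huv⟩ := hG.exists_adj_of_notMem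
    (S := (X ∪ nbhdFinset G X : Finset V)) (x := x) (y := a)
    (mem_coe.2 (mem_union_left _ hx)) (by simp [haX, haN])
  obtain ⟨m, hm, hMm⟩ := exists_isMate_of_isPerfectMatching hM
  have himg : X.image m = nbhdFinset G X := by
    refine eq_of_subset_of_card_le (fun y hy => ?_) ?_
    · obtain ⟨z, hz, rfl⟩ := mem_image.1 hy
      exact mem_nbhdFinset.2 ⟨z, hz, hm.adj z⟩
    · rwa [card_image_of_injective _ hm.injective]
  rw [hMm] at huv
  subst huv
  apply hv
  rw [mem_coe, mem_union] at hu ⊢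
  rcases hu with hu | hu
  · exact Or.inr (himg ▸ mem_image_of_mem m hu)
  · rw [← himg] at hu
    obtain ⟨z, hz, rfl⟩ := mem_image.1 hu
    rw [hm.mate_mate]
    exact Or.inl hz

end Surplus

/-! ### Ear decompositions give bistability -/

section Necessity

variable [DecidableEq V]

/-- The inner vertices of a path. -/
def inner {u v : V} (p : G.Walk u v) : Finset V := p.support.toFinset \ {u, v}

lemma mem_inner {u v w : V} {p : G.Walk u v} :
    w ∈ inner p ↔ w ∈ p.support ∧ w ≠ u ∧ w ≠ v := by
  simp [inner]

/-- How a stable set meets the inner vertices of a path joining the two color classes. -/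
structure InnerBound {u v : V} (A B S : Finset V) (p : G.Walk u v) : Prop where
  card_eq : (A ∩ inner p).card = (B ∩ inner p).card
  card_le : (S ∩ inner p).card ≤ (A ∩ inner p).card
  eq_left : (S ∩ inner p).card = (A ∩ inner p).card → u ∈ S → S ∩ inner p = A ∩ inner p
  eq_right : (S ∩ inner p).card = (A ∩ inner p).card → v ∈ S → S ∩ inner p = B ∩ inner p
  not_both : (S ∩ inner p).card = (A ∩ inner p).card → u ∈ S → v ∉ S

lemma inner_cons_cons {u x w v : V} (h : G.Adj u x) (h' : G.Adj x w) (q : G.Walk w v)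
    (hp : (Walk.cons h (Walk.cons h' q)).IsPath) (hwv : w ≠ v) :
    inner (Walk.cons h (Walk.cons h' q)) = insert x (insert w (inner q)) := by
  simp only [Walk.cons_isPath_iff, Walk.support_cons, List.mem_cons, not_or] at hp
  ext y
  have hw := q.start_mem_support
  have hv := q.end_mem_support
  simp only [mem_inner, mem_insert, Walk.support_cons, List.mem_cons]
  constructor
  · rintro ⟨rfl | rfl | h1, h2, h3⟩
    · exact absurd rfl h2
    · exact Or.inl rfl
    · by_cases hyw : y = w
      · exact Or.inr (Or.inl hyw)
      · exact Or.inr (Or.inr ⟨h1, hyw, h3⟩)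
  · rintro (rfl | rfl | ⟨h1, h2, h3⟩)
    · refine ⟨Or.inr (Or.inl rfl), h.ne', ?_⟩
      rintro rfl
      exact hp.1.2 hv
    · refine ⟨Or.inr (Or.inr hw), ?_, hwv⟩
      rintro rfl
      exact hp.2.2 hw
    · refine ⟨Or.inr (Or.inr h1), ?_, h3⟩
      rintro rfl
      exact hp.2.2 h1

/-- The inner vertices split into consecutive adjacent pairs `x ∈ B`, `w ∈ A`, and `S` takes at most
one of each. In case of equality it takes exactly one, and an end of the path in `S` forces the same
class in all pairs. The induction peels off one pair. -/
lemma innerBound_of_isPath (h : IsSplit G A B) (S : Finset V) : ∀ {u v : V} (p : G.Walk u v),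
    p.IsPath → u ∈ A → v ∈ B → (∀ x ∈ S, ∀ y ∈ S, ¬ p.toSubgraph.Adj x y) → InnerBound A B S p
  | _, _, .nil, _, hu, hv, _ => absurd hv (h.notMem _ hu)
  | u, v, .cons huv .nil, _, hu, hv, hS => by
    have : inner (Walk.cons huv .nil) = ∅ := by
      ext y
      simp [mem_inner]
      tauto
    refine ⟨?_, ?_, ?_, ?_, ?_⟩ <;> simp only [this, inter_empty, implies_true, le_refl]
    exact fun _ hu' hv' => hS u hu' v hv' (by simp)
  | u, v, .cons (v := x) hux (.cons (v := w) hxw q), hp, hu, hv, hS => by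
    have hx : x ∈ B := h.left _ _ hux hu
    have hw : w ∈ A := h.right _ _ hxw hx
    have hxA := h.symm.notMem x hx
    have hwB := h.notMem w hw
    have hwv : w ≠ v := by
      rintro rfl
      exact hwB hv
    have ih := innerBound_of_isPath h S q hp.of_cons.of_cons hw hv fun y hy z hz hyz =>
      hS y hy z hz (by simp [hyz])
    have hS1 : u ∈ S → x ∉ S := fun h1 h2 => hS u h1 x h2 (by simp)
    have hS2 : w ∈ S → x ∉ S := fun h1 h2 => hS x h2 w h1 (by simp)
    have hin := inner_cons_cons hux hxw q hp hwv
    have hwq : w ∉ inner q := fun h' => (mem_inner.1 h').2.1 rfl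
    have hxq : x ∉ inner q := fun h' =>
      (Walk.cons_isPath_iff _ _).1 hp.of_cons |>.2 (mem_inner.1 h').1
    have hxw' : x ≠ w := hxw.ne
    have hA : A ∩ inner (.cons hux (.cons hxw q)) = insert w (A ∩ inner q) := by
      rw [hin, inter_insert_of_notMem hxA, inter_insert_of_mem hw]
    have hB : B ∩ inner (.cons hux (.cons hxw q)) = insert x (B ∩ inner q) := by
      rw [hin, inter_insert_of_mem hx, inter_insert_of_notMem hwB]
    have hAc : (A ∩ inner (.cons hux (.cons hxw q))).card = (A ∩ inner q).card + 1 := by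
      rw [hA, card_insert_of_notMem fun h' => hwq (mem_inter.1 h').2]
    have hBc : (B ∩ inner (.cons hux (.cons hxw q))).card = (B ∩ inner q).card + 1 := by
      rw [hB, card_insert_of_notMem fun h' => hxq (mem_inter.1 h').2]
    have hSc : S ∩ inner (.cons hux (.cons hxw q)) = insert w (S ∩ inner q) ∧ w ∈ S ∧ x ∉ S ∧
          (S ∩ inner (.cons hux (.cons hxw q))).card = (S ∩ inner q).card + 1 ∨
        S ∩ inner (.cons hux (.cons hxw q)) = insert x (S ∩ inner q) ∧ w ∉ S ∧ x ∈ S ∧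
          (S ∩ inner (.cons hux (.cons hxw q))).card = (S ∩ inner q).card + 1 ∨
        (S ∩ inner (.cons hux (.cons hxw q))).card = (S ∩ inner q).card := by
      by_cases hwS : w ∈ S
      · have hxS := hS2 hwS
        left
        rw [hin, inter_insert_of_notMem hxS, inter_insert_of_mem hwS,
          card_insert_of_notMem fun h' => hwq (mem_inter.1 h').2]
        exact ⟨rfl, hwS, hxS, rfl⟩
      · right
        by_cases hxS : x ∈ S
        · left
          rw [hin, inter_insert_of_mem hxS, inter_insert_of_notMem hwS,
            card_insert_of_notMem fun h' => hxq (mem_inter.1 h').2]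
          exact ⟨rfl, hwS, hxS, rfl⟩
        · right
          rw [hin, inter_insert_of_notMem hxS, inter_insert_of_notMem hwS]
    have hle := ih.card_le
    have hce := ih.card_eq
    refine ⟨by omega, ?_, fun hc huS => ?_, fun hc hvS => ?_, fun hc huS hvS => ?_⟩
    · rcases hSc with h1 | h1 | h1 <;> omega
    · rcases hSc with h1 | h1 | h1
      · rw [h1.1, hA, ih.eq_left (by omega) h1.2.1]
      · exact absurd h1.2.2.1 (hS1 huS)
      · omega
    · rcases hSc with h1 | h1 | h1
      · exact absurd hvS (ih.not_both (by omega) h1.2.1)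
      · rw [h1.1, hB, ih.eq_right (by omega) hvS]
      · omega
    · rcases hSc with h1 | h1 | h1
      · exact ih.not_both (by omega) h1.2.1 hvS
      · exact hS1 huS h1.2.2.1
      · omega

/-- The color classes of the subgraph `H` of `G`, whose vertex set is `W`, have equal size and are
exactly the maximum stable sets of `H`. -/
structure IsBistableOn (A B : Finset V) (H : G.Subgraph) (W : Finset V) : Prop where
  verts_eq : (W : Set V) = H.verts
  card_eq : (A ∩ W).card = (B ∩ W).card
  card_le : ∀ S ⊆ W, (∀ x ∈ S, ∀ y ∈ S, ¬ H.Adj x y) → S.card ≤ (A ∩ W).card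
  eq_or_eq : ∀ S ⊆ W, (∀ x ∈ S, ∀ y ∈ S, ¬ H.Adj x y) → S.card = (A ∩ W).card →
    S = A ∩ W ∨ S = B ∩ W

lemma isBistableOn_subgraphOfAdj_of_mem (h : IsSplit G A B) {u v : V} (huv : G.Adj u v)
    (hu : u ∈ A) : IsBistableOn A B (G.subgraphOfAdj huv) {u, v} := by
  have hv : v ∈ B := h.left _ _ huv hu
  have hA : A ∩ {u, v} = {u} := by
    rw [inter_insert_of_mem hu, inter_singleton_of_notMem (h.symm.notMem v hv)]
    rfl
  have hB : B ∩ {u, v} = {v} := by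
    rw [inter_insert_of_notMem (h.notMem u hu), inter_singleton_of_mem hv]
  have hS1 : ∀ S ⊆ ({u, v} : Finset V),
      (∀ x ∈ S, ∀ y ∈ S, ¬ (G.subgraphOfAdj huv).Adj x y) → S ⊆ {u} ∨ S ⊆ {v} := by
    intro S hS hst
    by_cases huS : u ∈ S
    · left
      intro y hy
      have := hS hy
      rw [mem_insert, mem_singleton] at this
      rcases this with rfl | rfl
      · exact mem_singleton_self _
      · exact absurd (by simp) (hst u huS y hy)
    · right
      intro y hy
      have := hS hy
      rw [mem_insert] at this
      exact this.resolve_left fun h' => huS (h' ▸ hy)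
  refine ⟨by simp, by rw [hA, hB]; rfl, fun S hS hst => ?_, fun S hS hst hc => ?_⟩
  · rw [hA]
    rcases hS1 S hS hst with h1 | h1
    · exact card_le_card h1
    · exact (card_le_card h1).trans_eq rfl
  · rw [hA] at hc ⊢
    rw [hB]
    rcases hS1 S hS hst with h1 | h1
    · exact Or.inl (eq_of_subset_of_card_le h1 hc.ge)
    · exact Or.inr (eq_of_subset_of_card_le h1 hc.ge)

lemma isBistableOn_subgraphOfAdj (h : IsSplit G A B) {u v : V} (huv : G.Adj u v) :
    IsBistableOn A B (G.subgraphOfAdj huv) {u, v} := by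
  rcases h.mem_or u with hu | hu
  · exact isBistableOn_subgraphOfAdj_of_mem h huv hu
  · have := isBistableOn_subgraphOfAdj_of_mem h huv.symm (h.right _ _ huv hu)
    rwa [Finset.pair_comm, subgraphOfAdj_symm] at this

/-- A maximum stable set is tight both on `W` and on the ear. Its trace on `W` is one color class,
so it contains the end `u` or `v`, which forces the same class inside the ear. -/
lemma IsBistableOn.addEar (h : IsSplit G A B) {H : G.Subgraph} {W : Finset V}
    (hH : IsBistableOn A B H W) {u v : V} {p : G.Walk u v} (hp : IsEar A B H p) :
    IsBistableOn A B (H ⊔ p.toSubgraph) (W ∪ inner p) := by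
  have hW : ∀ x, x ∈ W ↔ x ∈ H.verts := fun x => by rw [← hH.verts_eq, mem_coe]
  have huW : u ∈ W := (hW u).2 hp.start_mem
  have hvW : v ∈ W := (hW v).2 hp.end_mem
  have hd : Disjoint W (inner p) := disjoint_left.2 fun x hx hx' => by
    rw [mem_inner] at hx'
    rcases hp.inter x hx'.1 ((hW x).1 hx) with h1 | h1
    · exact hx'.2.1 h1
    · exact hx'.2.2 h1
  have hcard : ∀ T : Finset V, (T ∩ (W ∪ inner p)).card = (T ∩ W).card + (T ∩ inner p).card :=
    fun T => by
      rw [inter_union_distrib_left, card_union_of_disjoint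
        (hd.mono inter_subset_right inter_subset_right)]
  have key : ∀ S ⊆ W ∪ inner p, (∀ x ∈ S, ∀ y ∈ S, ¬ (H ⊔ p.toSubgraph).Adj x y) →
      (∀ x ∈ S ∩ W, ∀ y ∈ S ∩ W, ¬ H.Adj x y) ∧ InnerBound A B S p ∧
        S.card = (S ∩ W).card + (S ∩ inner p).card := by
    intro S hS hst
    refine ⟨fun x hx y hy hxy =>
      hst x (mem_inter.1 hx).1 y (mem_inter.1 hy).1 (Subgraph.sup_adj.2 (Or.inl hxy)),
      innerBound_of_isPath h S p hp.isPath hp.start_mem_class hp.end_mem_class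
        fun x hx y hy hxy => hst x hx y hy (Subgraph.sup_adj.2 (Or.inr hxy)), ?_⟩
    rw [← hcard, inter_eq_left.2 hS]
  have hce : (A ∩ inner p).card = (B ∩ inner p).card :=
    (innerBound_of_isPath h ∅ p hp.isPath hp.start_mem_class hp.end_mem_class (by simp)).card_eq
  refine ⟨?_, ?_, fun S hS hst => ?_, fun S hS hst hc => ?_⟩
  · ext x
    have h1 := hW x
    rw [mem_coe, mem_union, mem_inner, Subgraph.verts_sup, Set.mem_union,
      Walk.mem_verts_toSubgraph, h1]
    constructor
    · tauto
    · rintro (h2 | h2)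
      · exact Or.inl h2
      · by_cases hxu : x = u
        · exact Or.inl (hxu ▸ hp.start_mem)
        · by_cases hxv : x = v
          · exact Or.inl (hxv ▸ hp.end_mem)
          · exact Or.inr ⟨h2, hxu, hxv⟩
  · rw [hcard, hcard, hH.card_eq, hce]
  · obtain ⟨h1, h2, h3⟩ := key S hS hst
    have := hH.card_le _ inter_subset_right h1
    have := h2.card_le
    rw [hcard]
    omega
  · obtain ⟨h1, h2, h3⟩ := key S hS hst
    have h4 := hH.card_le _ inter_subset_right h1
    have h5 := h2.card_le
    rw [hcard] at hc
    have hSd : S = (S ∩ W) ∪ (S ∩ inner p) := by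
      rw [← inter_union_distrib_left, inter_eq_left.2 hS]
    rcases hH.eq_or_eq _ inter_subset_right h1 (by omega) with h6 | h6
    · left
      have huS : u ∈ S ∩ W := h6 ▸ mem_inter.2 ⟨hp.start_mem_class, huW⟩
      rw [hSd, h6, h2.eq_left (by omega) (mem_inter.1 huS).1, inter_union_distrib_left]
    · right
      have hvS : v ∈ S ∩ W := h6 ▸ mem_inter.2 ⟨hp.end_mem_class, hvW⟩
      rw [hSd, h6, h2.eq_right (by omega) (mem_inter.1 hvS).1, inter_union_distrib_left]

lemma EarBuilt.exists_isBistableOn (h : IsSplit G A B) {H : G.Subgraph} (hH : EarBuilt A B H) :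
    ∃ W, IsBistableOn A B H W := by
  induction hH with
  | base huv => exact ⟨_, isBistableOn_subgraphOfAdj h huv⟩
  | addEar p _ hp ih =>
    obtain ⟨W, hW⟩ := ih
    exact ⟨_, hW.addEar h hp⟩

lemma HasEarDecomposition.isBistable [Fintype V] (h : IsSplit G A B)
    (hG : HasEarDecomposition G A B) : IsBistable G A B := by
  obtain ⟨W, hW⟩ := EarBuilt.exists_isBistableOn h hG
  have hWu : W = univ := by
    apply coe_injective
    rw [hW.verts_eq, coe_univ]
    rfl
  have hcard := hW.card_eq
  have hle := hW.card_le
  have heq := hW.eq_or_eq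
  simp only [hWu, subset_univ, inter_univ, true_imp_iff, Subgraph.top_adj] at hcard hle heq
  have hst : ∀ S : Finset V, G.IsIndepSet (S : Set V) → ∀ x ∈ S, ∀ y ∈ S, ¬ G.Adj x y :=
    fun S hS x hx y hy hxy => hS hx hy hxy.ne hxy
  have hA : G.IsMaximumIndepSet A := ⟨isIndepSet_left h, fun T hT => hle T (hst T hT)⟩
  have hB : G.IsMaximumIndepSet B :=
    isMaximumIndepSet_of_card_le hA (isIndepSet_left h.symm) hcard.le
  intro S
  constructor
  · intro hS
    exact heq S (hst S hS.isIndepSet)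
      (le_antisymm (hle S (hst S hS.isIndepSet)) (hS.maximum A hA.isIndepSet))
  · rintro (rfl | rfl)
    · exact hA
    · exact hB

end Necessity

/-! ### Surplus gives an ear decomposition -/

section Sufficiency

/-- Paths from a vertex of `B` outside `W` to a vertex of `B` in `W` that alternate between edges
`b (m b)` outside `W` and arbitrary edges. -/
inductive AltWalk (B : Finset V) (W : Set V) (m : V → V) : ∀ {b v : V}, G.Walk b v → Prop
  | last {b v : V} (hb : b ∈ B) (hbW : b ∉ W) (hm : G.Adj b (m b)) (hv : G.Adj (m b) v)
      (hvB : v ∈ B) (hvW : v ∈ W) : AltWalk B W m (Walk.cons hm (Walk.cons hv Walk.nil))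
  | step {b b' v : V} {q : G.Walk b' v} (hb : b ∈ B) (hbW : b ∉ W) (hm : G.Adj b (m b))
      (hb' : G.Adj (m b) b') (hq : AltWalk B W m q) (hbq : b ∉ q.support)
      (hmq : m b ∉ q.support) : AltWalk B W m (Walk.cons hm (Walk.cons hb' q))

namespace AltWalk

variable {W : Set V} {m : V → V} {b v : V} {q : G.Walk b v}

lemma even_length (hq : AltWalk B W m q) : Even q.length := by
  induction hq with
  | last => simp
  | step _ _ _ _ _ _ _ ih =>
    rw [Walk.length_cons, Walk.length_cons, add_assoc]
    exact ih.add even_two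

lemma end_mem (hq : AltWalk B W m q) : v ∈ B ∧ v ∈ W := by
  induction hq with
  | last _ _ _ _ h1 h2 => exact ⟨h1, h2⟩
  | step _ _ _ _ _ _ _ ih => exact ih

lemma isPath (hq : AltWalk B W m q) : q.IsPath := by
  induction hq with
  | last _ hbW hm hv _ hvW =>
    simp only [Walk.cons_isPath_iff, Walk.support_cons, Walk.support_nil, List.mem_cons,
      List.not_mem_nil, or_false, not_or]
    refine ⟨⟨Walk.IsPath.nil, hv.ne⟩, hm.ne, ?_⟩
    rintro rfl
    exact hbW hvW
  | step _ _ hm _ _ hbq hmq ih =>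
    simp only [Walk.cons_isPath_iff, Walk.support_cons, List.mem_cons, not_or]
    exact ⟨⟨ih, hmq⟩, hm.ne, hbq⟩

lemma eq_end_of_mem (hq : AltWalk B W m q) (hW : ∀ x, m x ∈ W ↔ x ∈ W) :
    ∀ w ∈ q.support, w ∈ W → w = v := by
  induction hq with
  | last _ hbW =>
    intro w hw hwW
    simp only [Walk.support_cons, Walk.support_nil, List.mem_cons, List.not_mem_nil,
      or_false] at hw
    rcases hw with rfl | rfl | rfl
    · exact absurd hwW hbW
    · exact absurd ((hW _).1 hwW) hbW
    · rfl
  | step _ hbW _ _ _ _ _ ih =>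
    intro w hw hwW
    simp only [Walk.support_cons, List.mem_cons] at hw
    rcases hw with rfl | rfl | hw
    · exact absurd hwW hbW
    · exact absurd ((hW _).1 hwW) hbW
    · exact ih w hw hwW

lemma mate_mem (hq : AltWalk B W m q) (hm : IsMate G m) :
    ∀ w ∈ q.support, w = v ∨ m w ∈ q.support := by
  induction hq with
  | last =>
    intro w hw
    simp only [Walk.support_cons, Walk.support_nil, List.mem_cons, List.not_mem_nil,
      or_false] at hw ⊢
    rcases hw with rfl | rfl | rfl
    · simp
    · simp [hm.mate_mate]
    · simp
  | step _ _ _ _ _ _ _ ih =>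
    intro w hw
    simp only [Walk.support_cons, List.mem_cons] at hw ⊢
    rcases hw with rfl | rfl | hw
    · simp
    · simp [hm.mate_mate]
    · have := ih w hw
      tauto

/-- A tail of an alternating path is alternating; this avoids repeated vertices when paths are
prolonged. -/
lemma exists_of_mem (hq : AltWalk B W m q) (h : IsSplit G A B) :
    ∀ w ∈ q.support, w ∈ B → w ∉ W → ∃ (v' : V) (q' : G.Walk w v'), AltWalk B W m q' := by
  induction hq with
  | last hb hbW hm hv hvB hvW =>
    intro w hw hwB hwW
    simp only [Walk.support_cons, Walk.support_nil, List.mem_cons, List.not_mem_nil,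
      or_false] at hw
    rcases hw with rfl | rfl | rfl
    · exact ⟨_, _, last hb hbW hm hv hvB hvW⟩
    · exact absurd hwB (h.notMem _ (h.right _ _ hm hb))
    · exact absurd hvW hwW
  | step hb hbW hm hb' hq hbq hmq ih =>
    intro w hw hwB hwW
    simp only [Walk.support_cons, List.mem_cons] at hw
    rcases hw with rfl | rfl | hw
    · exact ⟨_, _, step hb hbW hm hb' hq hbq hmq⟩
    · exact absurd hwB (h.notMem _ (h.right _ _ hm hb))
    · exact ih w hw hwB hwW

end AltWalk

variable [Fintype V]

/-- Otherwise `m` would embed `N(X)` in `X`. -/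
lemma HasSurplus.exists_adj_mate_notMem (hG : HasSurplus G A) {m : V → V} (hm : IsMate G m)
    {X : Finset V} (hX : X.Nonempty) (hXA : X ⊂ A) : ∃ x ∈ X, ∃ b, G.Adj x b ∧ m b ∉ X := by
  classical
  by_contra! hall
  refine (hasSurplus_iff.1 hG X hX hXA).not_ge ?_
  refine card_le_card_of_injOn m (fun y hy => ?_) hm.injective.injOn
  obtain ⟨x, hx, hxy⟩ := mem_nbhdFinset.1 hy
  exact hall x hx y hxy

lemma HasSurplus.exists_altWalk (hG : HasSurplus G A) (h : IsSplit G A B) {m : V → V}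
    (hm : IsMate G m) {W : Set V} (hW : ∀ x, m x ∈ W ↔ x ∈ W) {a₀ : V} (ha₀ : a₀ ∈ A)
    (ha₀W : a₀ ∈ W) {b : V} (hb : b ∈ B) (hbW : b ∉ W) :
    ∃ (v : V) (q : G.Walk b v), AltWalk B W m q := by
  classical
  by_contra hbad
  -- `Z` collects the partners of the bad vertices. It misses `a₀`, so surplus yields an edge from
  -- some `a ∈ Z` to a `b'` that lies in `W` or is good; through it `m a` becomes good.
  let Z : Finset V := A.filter fun a =>
    a ∉ W ∧ ¬ ∃ (v : V) (q : G.Walk (m a) v), AltWalk B W m q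
  have hZ : ∀ a, a ∈ Z ↔ a ∈ A ∧ a ∉ W ∧
    ¬ ∃ (v : V) (q : G.Walk (m a) v), AltWalk B W m q := fun a => by simp [Z]
  obtain ⟨a, haZ, b', hab', hb'Z⟩ := hG.exists_adj_mate_notMem hm (X := Z)
    ⟨m b, (hZ _).2 ⟨hm.mem_left h hb, fun h' => hbW ((hW b).1 h'), by rwa [hm.mate_mate]⟩⟩
    ⟨filter_subset _ _, fun h' => ((hZ a₀).1 (h' ha₀)).2.1 ha₀W⟩
  obtain ⟨haA, haW, hbad'⟩ := (hZ a).1 haZ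
  have hb'B : b' ∈ B := h.left _ _ hab' haA
  have hmaB : m a ∈ B := hm.mem_right h haA
  have hmaW : m a ∉ W := fun h' => haW ((hW a).1 h')
  have hadj : G.Adj (m (m a)) b' := by rwa [hm.mate_mate]
  apply hbad'
  by_cases hb'W : b' ∈ W
  · exact ⟨b', _, AltWalk.last hmaB hmaW (hm.adj _) hadj hb'B hb'W⟩
  · have hgood : ∃ (v : V) (q : G.Walk b' v), AltWalk B W m q := by
      by_contra hbad''
      exact hb'Z ((hZ _).2 ⟨hm.mem_left h hb'B, fun h' => hb'W ((hW b').1 h'), by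
        rwa [hm.mate_mate]⟩)
    obtain ⟨v, q, hq⟩ := hgood
    by_cases hmaq : m a ∈ q.support
    · exact hq.exists_of_mem h _ hmaq hmaB hmaW
    · refine ⟨v, _, AltWalk.step hmaB hmaW (hm.adj _) hadj hq hmaq fun h' => ?_⟩
      rw [hm.mate_mate] at h'
      rcases hq.mate_mem hm a h' with h1 | h1
      · exact haW (h1 ▸ hq.end_mem.2)
      · exact hmaq h1

/-- `H` is maximal among the ear-built subgraphs with `m`-closed vertex set. The closure makes an
alternating path starting outside `H` stay outside until its last vertex. -/
lemma HasSurplus.hasEarDecomposition (hG : HasSurplus G A) (h : IsSplit G A B) {m : V → V}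
    (hm : IsMate G m) (hA : A.Nonempty) : HasEarDecomposition G A B := by
  classical
  obtain ⟨a, ha⟩ := hA
  obtain ⟨H, ⟨hH, hHm⟩, hmax⟩ := Set.Finite.exists_maximal
    (Set.toFinite {H : G.Subgraph | EarBuilt A B H ∧ ∀ x, m x ∈ H.verts ↔ x ∈ H.verts})
    ⟨G.subgraphOfAdj (hm.adj a), EarBuilt.base _, fun x => by
      simp only [subgraphOfAdj_verts, Set.mem_insert_iff, Set.mem_singleton_iff,
        hm.injective.eq_iff]
      constructor
      · rintro (rfl | rfl)
        · exact Or.inr (hm.mate_mate _).symm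
        · exact Or.inl rfl
      · rintro (rfl | rfl)
        · exact Or.inr rfl
        · exact Or.inl (hm.mate_mate _)⟩
  have hadd : ∀ {u v : V} (p : G.Walk u v), IsEar A B H p →
      (∀ x ∈ p.support, x ∈ H.verts ∨ m x ∈ p.support) → p.toSubgraph ≤ H := by
    intro u v p hp hpm
    have himp : ∀ x, x ∈ (H ⊔ p.toSubgraph).verts → m x ∈ (H ⊔ p.toSubgraph).verts := by
      intro x hx
      rw [Subgraph.verts_sup, Set.mem_union, Walk.mem_verts_toSubgraph] at hx ⊢
      rw [hHm]
      rcases hx with hx | hx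
      · exact Or.inl hx
      · exact hpm x hx
    exact le_sup_right.trans (hmax ⟨EarBuilt.addEar p hH hp, fun x =>
      ⟨fun hx => hm.mate_mate x ▸ himp _ hx, himp x⟩⟩ le_sup_left)
  have hHA : ∃ a₀ ∈ A, a₀ ∈ H.verts := by
    have hne : ∃ x, x ∈ H.verts := by
      cases hH with
      | base huv => exact ⟨_, Or.inl rfl⟩
      | addEar p _ hp => exact ⟨_, Or.inl hp.start_mem⟩
    obtain ⟨x, hx⟩ := hne
    rcases h.mem_or x with hxA | hxB
    · exact ⟨x, hxA, hx⟩
    · exact ⟨m x, hm.mem_left h hxB, (hHm x).2 hx⟩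
  obtain ⟨a₀, ha₀, ha₀H⟩ := hHA
  have hspan : ∀ x, x ∈ H.verts := by
    by_contra! hex
    have hex' : ∃ a₁ ∈ A, a₁ ∉ H.verts := by
      obtain ⟨x, hx⟩ := hex
      rcases h.mem_or x with hxA | hxB
      · exact ⟨x, hxA, hx⟩
      · exact ⟨m x, hm.mem_left h hxB, fun h' => hx ((hHm x).1 h')⟩
    obtain ⟨a₁, ha₁, ha₁H⟩ := hex'
    -- Surplus of `A ∩ V(H)` gives an edge `xb` leaving `H`; an alternating path from `b` back to
    -- `H` completes it to an ear, against maximality.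
    obtain ⟨x, hx, b, hxb, hbX⟩ := hG.exists_adj_mate_notMem hm
      (X := A.filter fun x => x ∈ H.verts) ⟨a₀, mem_filter.2 ⟨ha₀, ha₀H⟩⟩
      ⟨filter_subset _ _, fun h' => ha₁H (mem_filter.1 (h' ha₁)).2⟩
    obtain ⟨hxA, hxH⟩ := mem_filter.1 hx
    have hbB : b ∈ B := h.left _ _ hxb hxA
    have hbH : b ∉ H.verts := fun h' =>
      hbX (mem_filter.2 ⟨hm.mem_left h hbB, (hHm b).2 h'⟩)
    obtain ⟨v, q, hq⟩ := hG.exists_altWalk h hm hHm ha₀ ha₀H hbB hbH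
    have hxq : x ∉ q.support := fun h' => by
      have := hq.eq_end_of_mem hHm x h' hxH
      exact h.notMem x hxA (this ▸ hq.end_mem.1)
    have hle := hadd (Walk.cons hxb q)
      { isPath := (Walk.cons_isPath_iff _ _).2 ⟨hq.isPath, hxq⟩
        even := by
          rw [Walk.length_support, Walk.length_cons, add_assoc]
          exact hq.even_length.add even_two
        start_mem_class := hxA
        end_mem_class := hq.end_mem.1
        start_mem := hxH
        end_mem := hq.end_mem.2
        inter := fun w hw hwH => by
          rw [Walk.support_cons, List.mem_cons] at hw
          exact hw.imp_right fun hw => hq.eq_end_of_mem hHm w hw hwH }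
      (fun y hy => by
        rw [Walk.support_cons, List.mem_cons] at hy ⊢
        rcases hy with rfl | hy
        · exact Or.inl hxH
        · rcases hq.mate_mem hm y hy with rfl | h1
          · exact Or.inl hq.end_mem.2
          · exact Or.inr (Or.inr h1))
    exact hbH (hle.1 (by simp))
  -- Once `H` spans, each single edge is an ear, so maximality puts it in `H`.
  have hadj : ∀ u ∈ A, ∀ v, G.Adj u v → H.Adj u v := by
    intro u hu v huv
    refine (hadd (Walk.cons huv Walk.nil) ⟨?_, by simp, hu, h.left _ _ huv hu, hspan u, hspan v,
      ?_⟩ fun x _ => Or.inl (hspan x)).2 (by simp)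
    · simpa using huv.ne
    · intro w hw _
      simpa using hw
  have htop : H = ⊤ := top_unique ⟨fun v _ => hspan v, fun u v huv => by
    have huv : G.Adj u v := huv
    rcases h.mem_or u with hu | hu
    · exact hadj u hu v huv
    · exact (hadj v (h.right _ _ huv hu) u huv.symm).symm⟩
  rw [HasEarDecomposition, ← htop]
  exact hH

end Sufficiency

end BistableGraph

theorem theorem4p3 {V : Type*} [Fintype V] [DecidableEq V] (G : SimpleGraph V) (A B : Finset V)
    (hG : BistableGraph.IsBipartition G A B) (hV : 4 ≤ Fintype.card V) :
    List.TFAE [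
      BistableGraph.IsCoverIrreducible G A B,
      BistableGraph.IsBistable G A B,
      BistableGraph.HasSurplus G A ∧ BistableGraph.HasSurplus G B,
      A.card = B.card ∧ BistableGraph.HasSurplus G A,
      ∀ a ∈ A, ∀ b ∈ B, BistableGraph.IsAlphaPlusStable (BistableGraph.deletePair G a b),
      ∀ a ∈ A, ∀ b ∈ B, BistableGraph.HasPerfectMatching (BistableGraph.deletePair G a b),
      G.Connected ∧ BistableGraph.EveryEdgeMatched G,
      BistableGraph.IsElementary G,
      BistableGraph.HasEarDecomposition G A B] := by
  have h := hG.isSplit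
  have hA := hG.left_nonempty
  have hB := hG.right_nonempty
  have hV' : 4 ≤ A.card + B.card := by
    have h1 := BistableGraph.card_inter_add_card_inter h Finset.univ
    rw [Finset.univ_inter, Finset.univ_inter, Finset.card_univ] at h1
    omega
  have : Nontrivial V := Fintype.one_lt_card_iff_nontrivial.1 (by omega)
  tfae_have 1 ↔ 2 := BistableGraph.isCoverIrreducible_iff_isBistable h
  tfae_have 2 → 3 := fun h2 => ⟨h2.hasSurplus h, h2.symm.hasSurplus h.symm⟩
  tfae_have 3 → 4 := fun h3 => ⟨BistableGraph.card_eq_of_hasSurplus h hV' h3.1 h3.2, h3.1⟩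
  -- Balance on at least four vertices gives `|A| ≥ 2`; for `|A| = 1` surplus would be vacuous.
  tfae_have 4 → 2 := fun h4 => h4.2.isBistable h (by omega) h4.1
  tfae_have 4 → 6 := fun h4 a ha b hb => h4.2.hasPerfectMatching_deletePair h h4.1 ha hb
  tfae_have 6 → 4 := fun h6 => by
    obtain ⟨a, ha⟩ := hA
    obtain ⟨b, hb⟩ := hB
    exact ⟨BistableGraph.card_eq_of_hasPerfectMatching_deletePair h ha hb (h6 a ha b hb),
      BistableGraph.hasSurplus_of_hasPerfectMatching_deletePair h ⟨b, hb⟩ h6⟩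
  tfae_have 5 ↔ 6 :=
    BistableGraph.hasPerfectMatching_deletePair_iff_isAlphaPlusStable h hV' hA hB
  tfae_have 6 → 7 := fun h6 => by
    have h4 := tfae_6_to_4 h6
    exact ⟨h4.2.connected h (by omega) h4.1,
      BistableGraph.everyEdgeMatched_of_hasPerfectMatching_deletePair h h6⟩
  tfae_have 7 → 8 := fun h7 => BistableGraph.isElementary_of_everyEdgeMatched h7.1 h7.2
  tfae_have 8 → 4 := fun h8 => h8.hasSurplus h
  tfae_have 9 → 2 := fun h9 => h9.isBistable h
  tfae_have 8 → 9 := fun h8 => by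
    obtain ⟨M, hM⟩ := h8.exists_isPerfectMatching
    obtain ⟨m, hm, -⟩ := BistableGraph.exists_isMate_of_isPerfectMatching hM
    exact (h8.hasSurplus h).2.hasEarDecomposition h hm hA
  tfae_finish
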